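/- Let $\rho$ be an odd prime with $\rho\equiv\pm5\pmod{12}$ such that the multiplicative order of $3$ modulo $\rho$ is $\rho-1$, and put $m=\rho-1$. Let $\alpha$ be a primitive element of $\mathrm{GF}(3^m)$, $\beta=\alpha^{(3^m-1)/(4\rho)}$ (a primitive $4\rho$-th root of unity) and $\theta=\beta^{-1}$. Consider the code over $\mathrm{GF}(3^2)$ of length $\rho$ $$\overline{\mathcal C}(\rho)=\left\{\left(\mathrm{Tr}_{3^m/3^2}(a\,\theta^{2i})\right)_{i=0}^{\rho-1}:\ a\in\mathrm{GF}(3^m)\right\},$$ where $\mathrm{Tr}_{3^m/3^2}$ is the trace from $\mathrm{GF}(3^m)$ to $\mathrm{GF}(3^2)$. Then $\overline{\mathcal C}(\rho)$ is negacyclic (if $(c_0,\ldots,c_{\rho-1})$ is a codeword, so is $(-c_{\rho-1},c_0,\ldots,c_{\rho-2})$) and is a linear code with parameters $[\rho,\frac{\rho-1}2,d]$, where the minimum Hamming distance satisfies $d\ge\sqrt\rho+1$. Its dual $\overline{\mathcal C}(\rho)^{\perp}=\{c\in\mathrm{GF}(3^2)^\rho:\ \sum_{i} c_ib_i=0\text{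 for all } b\in\overline{\mathcal C}(\rho)\}$ has parameters $[\rho,\frac{\rho+1}2,d^\perp]$ with $d^\perp\ge\sqrt\rho$. -/

import Mathlib

namespace Negacyclic

/-- A linear code of length `n` over `K` is `lam`-constacyclic if `(c_0, ..., c_{n-1}) ∈ C`
implies `(lam * c_{n-1}, c_0, ..., c_{n-2}) ∈ C`. -/
def IsConstacyclic {K : Type*} [Field K] {n : ℕ} (lam : K) (C : Submodule K (Fin n → K)) : Prop :=
  ∀ c ∈ C, (fun i : Fin n =>
    if i.val = 0 then lam * c ⟨n - 1, Nat.sub_lt i.pos one_pos⟩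
    else c ⟨i.val - 1, (Nat.sub_le _ _).trans_lt i.isLt⟩) ∈ C

/-- A negacyclic code is a `(-1)`-constacyclic code. -/
def IsNegacyclic {K : Type*} [Field K] {n : ℕ} (C : Submodule K (Fin n → K)) : Prop :=
  IsConstacyclic (-1 : K) C

/-- The (Euclidean) dual code. -/
def dualCode {K : Type*} [Field K] {n : ℕ} (C : Submodule K (Fin n → K)) :
    Submodule K (Fin n → K) where
  carrier := {c | ∀ b ∈ C, ∑ i, c i * b i = 0}
  zero_mem' := by
    intro b _
    simp
  add_mem' := by
    intro x y hx hy b hb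
    simp [add_mul, Finset.sum_add_distrib, hx b hb, hy b hb]
  smul_mem' := by
    intro r x hx b hb
    simp [mul_assoc, ← Finset.mul_sum, hx b hb]

open Classical in
/-- The minimum Hamming distance between two distinct codewords of a linear code
(with value `0` for the zero code, which has no two distinct codewords). -/
noncomputable def minDist {K : Type*} [Field K] {n : ℕ} (C : Submodule K (Fin n → K)) : ℕ :=
  sInf {d : ℕ | ∃ x ∈ C, ∃ y ∈ C, x ≠ y ∧ hammingDist x y = d}

/-- An `[n, k, d]` linear code over `K`: a `k`-dimensional subspace of `K^n` with minimum
distance `d`. -/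
def HasParameters {K : Type*} [Field K] {n : ℕ} (C : Submodule K (Fin n → K)) (k d : ℕ) : Prop :=
  Module.finrank K C = k ∧ minDist C = d

/-- With `θ = β⁻¹`, the code of all words `(Tr_{L/K}(a θ^{2 i}))_{0 ≤ i ≤ ρ - 1}`, `a ∈ L`. -/
noncomputable def barCode (K : Type*) {L : Type*} [Field K] [Field L] [Algebra K L]
    (ρ : ℕ) (β : L) : Submodule K (Fin ρ → K) :=
  LinearMap.range (LinearMap.pi fun i : Fin ρ =>
    Algebra.trace K L ∘ₗ LinearMap.mulRight K (β⁻¹ ^ (2 * i.val)))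

theorem mem_barCode {K L : Type*} [Field K] [Field L] [Algebra K L] (ρ : ℕ) (β : L)
    (c : Fin ρ → K) :
    c ∈ barCode K ρ β ↔
      ∃ a : L, c = fun i : Fin ρ => Algebra.trace K L (a * β⁻¹ ^ (2 * i.val)) := by
  constructor
  · rintro ⟨a, rfl⟩
    exact ⟨a, rfl⟩
  · rintro ⟨a, rfl⟩
    exact ⟨a, rfl⟩

end Negacyclic

namespace Negacyclic

/-! ### Values of quadratic characters. -/

section QuadraticCharacter

variable {F L : Type*} [Field F] [Field L] {χ : MulChar F L}

/-! Put γ = θ². It has order 2ρ, so -γ is a primitive ρ-th root of unity, and alternating the signs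
of coordinates (`twist`), which preserves weights, makes both codes cyclic. Since 3 generates the
units mod ρ, the powers of 9 are exactly the nonzero squares, and the twisted codes lie in quadratic
residue codes over GF(9): a trace word has Fourier transform supported on the -9^j, hence zero at 0
(even-like), and a dual word has transform zero at 1, hence at all squares by Frobenius.

Weights: convolving an odd-like word (transform nonzero at 0) with its nonresidue dilate gives a
nonzero constant, so w² ≥ ρ (`card_le_support_sq`). An even-like word is an eigenvector of the Paley
matrix; after translating a nonzero coordinate to 0, the inversion x ↦ -1/x discards that coordinate
and yields an odd-like word, so (w - 1)² ≥ ρ (`card_le_support_sub_one_sq`).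

Dimensions: 9 has order (ρ-1)/2 mod ρ, so γ generates L over K, and the trace form is nondegenerate.
-/

theorem _root_.MulChar.IsQuadratic.eq_one_or_neg_one (hχ : χ.IsQuadratic) {x : F} (hx : x ≠ 0) :
    χ x = 1 ∨ χ x = -1 := by
  rcases hχ x with h | h
  · exact absurd h (IsUnit.map χ (Ne.isUnit hx)).ne_zero
  · exact h

theorem _root_.MulChar.IsQuadratic.eq_neg_of_ne (hχ : χ.IsQuadratic) {x : F} (hx : x ≠ 0)
    {ε : L} (hε : ε = 1 ∨ ε = -1) (h : χ x ≠ ε) : χ x = -ε := by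
  rcases hε with rfl | rfl
  · exact (hχ.eq_one_or_neg_one hx).resolve_left h
  · rw [neg_neg]
    exact (hχ.eq_one_or_neg_one hx).resolve_right h

theorem _root_.MulChar.IsQuadratic.mul_self (hχ : χ.IsQuadratic) {x : F} (hx : x ≠ 0) :
    χ x * χ x = 1 := by
  rcases hχ.eq_one_or_neg_one hx with h | h <;> simp [h]

theorem _root_.MulChar.IsQuadratic.exists_eq_neg_one (hχ : χ.IsQuadratic) (h1 : χ ≠ 1) :
    ∃ n : F, n ≠ 0 ∧ χ n = -1 := by
  obtain ⟨u, hu⟩ := MulChar.ne_one_iff.1 h1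
  exact ⟨u, u.ne_zero, (hχ.eq_one_or_neg_one u.ne_zero).resolve_left hu⟩

end QuadraticCharacter

/-! ### Fourier analysis and square root bounds for quadratic residue codes. -/

section QuadraticResidue

variable {F L : Type*} [Field F] [Fintype F] [Field L]

/-- The Fourier transform of `f : F → L` with respect to the additive character `ψ`. -/
def fourier (ψ : AddChar F L) (f : F → L) (r : F) : L := ∑ x, f x * ψ (x * r)

theorem fourier_zero (ψ : AddChar F L) (f : F → L) : fourier ψ f 0 = ∑ x, f x := by
  simp [fourier]

theorem fourier_inversion {ψ : AddChar F L} (hψ : ψ.IsPrimitive) (f : F → L) (y : F) :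
    ∑ r, fourier ψ f r * ψ (-(r * y)) = Fintype.card F * f y := by
  classical
  calc ∑ r, fourier ψ f r * ψ (-(r * y))
      = ∑ r, ∑ x, f x * ψ (r * (x - y)) := by
        refine Finset.sum_congr rfl fun r _ => ?_
        rw [fourier, Finset.sum_mul]
        refine Finset.sum_congr rfl fun x _ => ?_
        rw [mul_assoc, ← AddChar.map_add_eq_mul]
        congr 2
        ring
    _ = ∑ x, f x * ∑ r, ψ (r * (x - y)) := by
        rw [Finset.sum_comm]
        simp only [Finset.mul_sum]
    _ = Fintype.card F * f y := by
        simp only [AddChar.sum_mulShift _ hψ, sub_eq_zero]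
        simp [mul_comm]

theorem eq_of_fourier_eq {ψ : AddChar F L} (hψ : ψ.IsPrimitive)
    (hF : (Fintype.card F : L) ≠ 0) {f g : F → L} (h : ∀ r, fourier ψ f r = fourier ψ g r) :
    f = g := by
  funext y
  refine mul_left_cancel₀ hF ?_
  rw [← fourier_inversion hψ, ← fourier_inversion hψ]
  simp only [h]

theorem fourier_add_convolution (ψ : AddChar F L) (f g : F → L) (r : F) :
    fourier ψ (fun z => ∑ y, f y * g (z - y)) r = fourier ψ f r * fourier ψ g r := by
  simp only [fourier, Finset.sum_mul]
  rw [Finset.sum_comm]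
  refine Finset.sum_congr rfl fun y _ => ?_
  rw [Finset.mul_sum, ← Equiv.sum_comp (Equiv.addRight y)]
  refine Finset.sum_congr rfl fun x _ => ?_
  simp only [Equiv.coe_addRight, add_sub_cancel_right, add_mul, AddChar.map_add_eq_mul]
  ring

theorem fourier_dilate (ψ : AddChar F L) (f : F → L) {n : F} (hn : n ≠ 0) (r : F) :
    fourier ψ (fun x => f (n * x)) r = fourier ψ f (n⁻¹ * r) := by
  simp only [fourier]
  rw [← Equiv.sum_comp (Equiv.mulLeft₀ n hn) (fun x => f x * ψ (x * (n⁻¹ * r)))]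
  refine Finset.sum_congr rfl fun x _ => ?_
  have : n * x * (n⁻¹ * r) = x * r := by field_simp
  simp [this]

theorem fourier_translate (ψ : AddChar F L) (f : F → L) (t r : F) :
    fourier ψ (fun x => f (x + t)) r = ψ (-(t * r)) * fourier ψ f r := by
  simp only [fourier]
  rw [← Equiv.sum_comp (Equiv.addRight t) (fun x => f x * ψ (x * r)), Finset.mul_sum]
  refine Finset.sum_congr rfl fun x _ => ?_
  rw [Equiv.coe_addRight, mul_left_comm, ← AddChar.map_add_eq_mul]
  congr 2
  ring

variable {χ : MulChar F L}

theorem sum_mulChar_mul_addChar (hχ : χ.IsQuadratic) (h1 : χ ≠ 1) (ψ : AddChar F L) (r : F) :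
    ∑ z, χ z * ψ (z * r) = χ r * gaussSum χ ψ := by
  rcases eq_or_ne r 0 with rfl | hr
  · simp [MulChar.sum_eq_zero_of_ne_one h1, MulChar.map_zero]
  · have h := gaussSum_mulShift χ ψ (Units.mk0 r hr)
    rw [← h, Units.val_mk0, ← mul_assoc, hχ.mul_self hr, one_mul, gaussSum]
    refine Finset.sum_congr rfl fun z _ => ?_
    rw [AddChar.mulShift_apply, mul_comm r]

/-- The Paley matrix is diagonalized by the Fourier transform. -/
theorem fourier_paley (hχ : χ.IsQuadratic) (h1 : χ ≠ 1) (ψ : AddChar F L) (f : F → L) (r : F) :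
    fourier ψ (fun x => ∑ y, χ (y - x) * f y) r
      = χ (-r) * gaussSum χ ψ * fourier ψ f r := by
  rw [← sum_mulChar_mul_addChar hχ h1]
  simp only [fourier, Finset.sum_mul, Finset.mul_sum]
  rw [Finset.sum_comm]
  refine Finset.sum_congr rfl fun y _ => ?_
  rw [← Equiv.sum_comp (Equiv.subLeft y)]
  refine Finset.sum_congr rfl fun z _ => ?_
  have : ψ ((y - z) * r) = ψ (z * -r) * ψ (y * r) := by
    rw [← AddChar.map_add_eq_mul]
    congr 1
    ring
  simp only [Equiv.subLeft_apply, sub_sub_cancel, this]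
  ring

theorem gaussSum_ne_zero {ψ : AddChar F L} (hχ : χ.IsQuadratic) (h1 : χ ≠ 1)
    (hψ : ψ.IsPrimitive) (hF : (Fintype.card F : L) ≠ 0) : gaussSum χ ψ ≠ 0 := by
  intro h
  have := gaussSum_sq h1 hχ hψ
  rw [h, zero_pow two_ne_zero] at this
  have h' : χ (-1) ≠ 0 := (IsUnit.map χ (isUnit_one.neg)).ne_zero
  exact mul_ne_zero h' hF this.symm

/-- The square root bound for odd-like words of quadratic residue codes. -/
theorem card_le_support_sq {ψ : AddChar F L} (hχ : χ.IsQuadratic) (h1 : χ ≠ 1)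
    (hψ : ψ.IsPrimitive) {ε : L} (hε : ε = 1 ∨ ε = -1)
    {f : F → L} (hf : ∀ r, χ r = ε → fourier ψ f r = 0) (h0 : fourier ψ f 0 ≠ 0) :
    Fintype.card F ≤ (Function.support f).ncard ^ 2 := by
  classical
  obtain ⟨n, hn, hχn⟩ := hχ.exists_eq_neg_one h1
  -- Dilating by a nonresidue swaps the two classes, so away from 0 one of the two transforms always
  -- vanishes.
  set g : F → L := fun x => f (n * x) with hg
  set h : F → L := fun z => ∑ y, f y * g (z - y) with hh
  have hfour : ∀ r, fourier ψ h r = fourier ψ f r * fourier ψ f (n⁻¹ * r) := fun r => by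
    rw [hh, fourier_add_convolution, hg, fourier_dilate ψ f hn]
  have hne : ∀ r, r ≠ 0 → fourier ψ h r = 0 := fun r hr => by
    rw [hfour]
    have hinv : χ (n⁻¹ * r) = - χ r := by
      have : χ n * χ (n⁻¹ * r) = χ r := by rw [← map_mul, mul_inv_cancel_left₀ hn]
      rw [hχn] at this
      linear_combination -this
    by_cases hr' : χ r = ε
    · rw [hf r hr', zero_mul]
    · rw [hf (n⁻¹ * r), mul_zero]
      rw [hinv]
      rw [hχ.eq_neg_of_ne hr hε hr', neg_neg]
  -- Only the frequency 0 survives, so `h` is a nonzero constant; every z is then a sum of points of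
  -- the two supports.
  have hconst : ∀ z, h z ≠ 0 := fun z hz => by
    have := fourier_inversion hψ h z
    rw [hz, mul_zero, Finset.sum_eq_single 0 (fun r _ hr => by rw [hne r hr, zero_mul])
      (by simp), hfour] at this
    simp [h0] at this
  have hsub : (Set.univ : Set F) ⊆
      (fun p : F × F => p.1 + n⁻¹ * p.2) '' (Function.support f ×ˢ Function.support f) := by
    intro z _
    obtain ⟨y, -, hy⟩ := Finset.exists_ne_zero_of_sum_ne_zero (hconst z)
    refine ⟨(y, n * (z - y)), ⟨left_ne_zero_of_mul hy, right_ne_zero_of_mul hy⟩, ?_⟩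
    simp [inv_mul_cancel_left₀ hn]
  have := (Set.ncard_le_ncard hsub (Set.toFinite _)).trans (Set.ncard_image_le (Set.toFinite _))
  rwa [Set.ncard_univ, Nat.card_eq_fintype_card, Set.ncard_prod, ← sq] at this

/-- The Gleason–Prange inversion of an even-like word of a quadratic residue code is a word of
the same code, and it is odd-like if the word does not vanish at `0`. -/
theorem fourier_inversion_map {ψ : AddChar F L} (hχ : χ.IsQuadratic) (h1 : χ ≠ 1)
    (hψ : ψ.IsPrimitive) (h2 : (2 : L) ≠ 0) (hF : (Fintype.card F : L) ≠ 0) {ε : L}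
    (hε : ε = 1 ∨ ε = -1) {f : F → L} (hf : ∀ r, χ r = ε → fourier ψ f r = 0)
    (h0 : fourier ψ f 0 = 0) (hf0 : f 0 ≠ 0) :
    (∀ r, χ r = ε → fourier ψ (fun x => χ x * f (-x⁻¹)) r = 0) ∧
      fourier ψ (fun x => χ x * f (-x⁻¹)) 0 ≠ 0 := by
  classical
  -- The Paley eigenvalue at the frequencies with χ r = -ε, the only ones present in `f`.
  set l : L := -(ε * χ (-1) * gaussSum χ ψ) with hl
  set g : F → L := fun x => χ x * f (-x⁻¹) with hg
  have hG := gaussSum_ne_zero hχ h1 hψ hF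
  have hm1 : χ (-1) ≠ 0 := (IsUnit.map χ (isUnit_one.neg)).ne_zero
  have hneg : ∀ r, χ (-r) = χ (-1) * χ r := fun r => by rw [← map_mul, neg_one_mul]
  have hε0 : ε ≠ 0 := by rcases hε with rfl | rfl <;> simp
  have hsum : ∑ x, f x = 0 := by rw [← fourier_zero ψ, h0]
  have heig : ∀ x, ∑ y, χ (y - x) * f y = l * f x := by
    refine congr_fun (eq_of_fourier_eq hψ hF (f := fun x => ∑ y, χ (y - x) * f y)
      (g := fun x => l * f x) fun r => ?_)
    have hmul : fourier ψ (fun x => l * f x) r = l * fourier ψ f r := by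
      simp only [fourier, Finset.mul_sum, mul_assoc]
    rw [fourier_paley hχ h1, hmul]
    rcases eq_or_ne r 0 with rfl | hr
    · rw [h0, mul_zero, mul_zero]
    by_cases hr' : χ r = ε
    · rw [hf r hr', mul_zero, mul_zero]
    · rw [hneg, hχ.eq_neg_of_ne hr hε hr', hl]
      ring
  have hg0 : g 0 = 0 := by simp [hg, MulChar.map_zero]
  have heig' : ∀ x, ∑ y, χ (y - x) * g y = l * g x - f 0 := by
    intro x
    -- The character values agree for u ≠ 0 because the arguments differ by the square u². At u = 0
    -- the convention 0⁻¹ = 0 and `g 0 = 0` make the left side vanish, whence the correction `f 0`.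
    have hterm : ∀ u, χ (-u⁻¹ - x) * g (-u⁻¹) = χ (1 + x * u) * f u - if u = 0 then f 0 else 0 := by
      intro u
      rcases eq_or_ne u 0 with rfl | hu
      · simp [hg0]
      · have : χ (1 + x * u) = χ (-u⁻¹ - x) * χ (-u⁻¹) := by
          have e : 1 + x * u = u * u * ((-u⁻¹ - x) * (-u⁻¹)) := by
            field_simp
            ring
          rw [e, map_mul, map_mul, hχ.mul_self hu, one_mul, map_mul]
        rw [this, hg]
        simp [hu, mul_assoc]
    let e : F ≃ F := (Equiv.inv F).trans (Equiv.neg F)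
    rw [← Equiv.sum_comp e]
    have : ∀ u, e u = -u⁻¹ := fun u => rfl
    simp only [this, hterm, Finset.sum_sub_distrib, Finset.sum_ite_eq', Finset.mem_univ, if_true]
    congr 1
    rcases eq_or_ne x 0 with rfl | hx
    · simp [hsum, hg0]
    · have hx' : ∀ u, χ (1 + x * u) * f u = χ x * (χ (u - -x⁻¹) * f u) := fun u => by
        rw [← mul_assoc, ← map_mul]
        congr 2
        field_simp
        ring
      simp only [hx', ← Finset.mul_sum, heig, hg]
      ring
  have hfour : ∀ r, χ (-r) * gaussSum χ ψ * fourier ψ g r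
      = l * fourier ψ g r - f 0 * if r = 0 then (Fintype.card F : L) else 0 := fun r => by
    rw [← fourier_paley hχ h1]
    simp only [heig']
    have := AddChar.sum_mulShift r hψ
    rw [apply_ite (Nat.cast : ℕ → L), Nat.cast_zero] at this
    rw [← this]
    simp only [fourier, sub_mul, Finset.sum_sub_distrib, Finset.mul_sum, mul_assoc]
  refine ⟨fun r hr => ?_, fun h => ?_⟩
  · have hr0 : r ≠ 0 := by
      rintro rfl
      exact hε0 (by rw [← hr, MulChar.map_zero])
    have := hfour r
    rw [if_neg hr0, hneg, hr, hl] at this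
    -- Where χ r = ε the Paley eigenvalue is -l, so the two sides differ by twice a nonzero multiple
    -- of the transform.
    have h' : (2 * (χ (-1) * ε * gaussSum χ ψ)) * fourier ψ g r = 0 := by
      linear_combination this
    exact (mul_eq_zero.1 h').resolve_left
      (mul_ne_zero h2 (mul_ne_zero (mul_ne_zero hm1 hε0) hG))
  -- Since χ 0 = 0, this reads l * ĝ(0) = f 0 * |F|, and the right side is nonzero.
  · have := hfour 0
    rw [h] at this
    simp [hf0, hF] at this

/-- Even-like words of quadratic residue codes satisfy the improved square root bound. -/
theorem card_le_support_sub_one_sq {ψ : AddChar F L} (hχ : χ.IsQuadratic) (h1 : χ ≠ 1)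
    (hψ : ψ.IsPrimitive) (h2 : (2 : L) ≠ 0) (hF : (Fintype.card F : L) ≠ 0) {ε : L}
    (hε : ε = 1 ∨ ε = -1) {f : F → L} (hf : ∀ r, χ r = ε → fourier ψ f r = 0)
    (h0 : fourier ψ f 0 = 0) (hne : f ≠ 0) :
    Fintype.card F ≤ ((Function.support f).ncard - 1) ^ 2 := by
  obtain ⟨t, ht⟩ := Function.ne_iff.1 hne
  set f' : F → L := fun x => f (x + t) with hf'
  have key := fourier_inversion_map (f := f') hχ h1 hψ h2 hF hε
    (fun r hr => by rw [hf', fourier_translate, hf r hr, mul_zero])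
    (by rw [hf', fourier_translate, h0, mul_zero]) (by simpa [hf'] using ht)
  refine (card_le_support_sq hχ h1 hψ hε key.1 key.2).trans (Nat.pow_le_pow_left ?_ 2)
  have ht' : t ∈ Function.support f := ht
  rw [← Set.ncard_sdiff_singleton_of_mem ht']
  -- The factor χ x removes x = 0, so the position t is never hit: this is the gain of one.
  refine Set.ncard_le_ncard_of_injOn (fun x => -x⁻¹ + t) (fun x hx => ⟨?_, ?_⟩) ?_ (Set.toFinite _)
  · exact right_ne_zero_of_mul hx
  · have hx0 : x ≠ 0 := by
      rintro rfl
      simp [MulChar.map_zero] at hx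
    simpa using hx0
  · intro x _ y _ hxy
    simpa using hxy

/-- All nonzero words of quadratic residue codes satisfy the square root bound. -/
theorem card_le_support_sq_of_ne_zero {ψ : AddChar F L} (hχ : χ.IsQuadratic) (h1 : χ ≠ 1)
    (hψ : ψ.IsPrimitive) (h2 : (2 : L) ≠ 0) (hF : (Fintype.card F : L) ≠ 0) {ε : L}
    (hε : ε = 1 ∨ ε = -1) {f : F → L} (hf : ∀ r, χ r = ε → fourier ψ f r = 0) (hne : f ≠ 0) :
    Fintype.card F ≤ (Function.support f).ncard ^ 2 := by
  by_cases h0 : fourier ψ f 0 = 0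
  · exact (card_le_support_sub_one_sq hχ h1 hψ h2 hF hε hf h0 hne).trans
      (Nat.pow_le_pow_left (Nat.sub_le _ _) 2)
  · exact card_le_support_sq hχ h1 hψ hε hf h0

end QuadraticResidue

end Negacyclic

namespace Negacyclic

/-! ### Minimum distance, trace codes and their duals. -/

section BasicCoding

variable {K : Type*} [Field K] {n : ℕ}

/-- The minimum distance of a nonzero linear code is attained as the weight of a nonzero word. -/
theorem exists_support_ncard_eq_minDist {C : Submodule K (Fin n → K)} (hC : C ≠ ⊥) :
    ∃ c ∈ C, c ≠ 0 ∧ (Function.support c).ncard = minDist C := by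
  classical
  obtain ⟨c, hc, hc0⟩ := Submodule.exists_mem_ne_zero_of_ne_bot hC
  have hne : {d : ℕ | ∃ x ∈ C, ∃ y ∈ C, x ≠ y ∧
      @hammingDist _ _ _ (fun _ => Classical.decEq K) x y = d}.Nonempty :=
    ⟨_, c, hc, 0, C.zero_mem, hc0, rfl⟩
  obtain ⟨x, hx, y, hy, hxy, h⟩ := Nat.sInf_mem hne
  refine ⟨x - y, C.sub_mem hx hy, sub_ne_zero.2 hxy, ?_⟩
  have h' : minDist C = hammingDist x y := by
    rw [minDist]
    convert h.symm
  rw [h', hammingDist, ← Set.ncard_coe_finset]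
  congr 1
  ext i
  simp [sub_eq_zero]

end BasicCoding

section TraceCode

variable {K L : Type*} [Field K] [Field L] [Algebra K L] {ρ : ℕ} {β : L}

theorem barCode_isNegacyclic (h0 : β ≠ 0) (hβ : β⁻¹ ^ (2 * ρ) = -1) :
    IsNegacyclic (barCode K ρ β) := by
  intro c hc
  obtain ⟨a, rfl⟩ := (mem_barCode ρ β c).1 hc
  -- Multiplying a by β² = θ⁻² shifts positions by one; the wrap-around sign is θ^(2ρ) = -1.
  refine (mem_barCode ρ β _).2 ⟨a * β ^ 2, ?_⟩
  funext i
  have key : ∀ k : ℕ, a * β ^ 2 * β⁻¹ ^ (2 * (k + 1)) = a * β⁻¹ ^ (2 * k) := fun k => by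
    rw [mul_add, pow_add, mul_one]
    field_simp
  split_ifs with hi
  · have hρ : 0 < ρ := i.pos
    have h := key (ρ - 1)
    rw [Nat.sub_add_cancel hρ, hβ] at h
    change -1 * Algebra.trace K L (a * β⁻¹ ^ (2 * (ρ - 1))) = _
    rw [← h, hi]
    simp
  · have h := key (i.val - 1)
    rw [Nat.sub_add_cancel (Nat.pos_of_ne_zero hi)] at h
    exact congr_arg _ h.symm

/-- Reducing exponents mod ρ costs only a sign, so the first ρ powers already span K[γ]. -/
theorem span_pow_eq_top [FiniteDimensional K L] (hρ : 0 < ρ) {γ : L} (hγ : γ ^ ρ = -1)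
    (htop : IntermediateField.adjoin K {γ} = ⊤) :
    Submodule.span K (Set.range fun i : Fin ρ => γ ^ i.val) = ⊤ := by
  set S := Submodule.span K (Set.range fun i : Fin ρ => γ ^ i.val) with hS
  have hmem : ∀ n : ℕ, γ ^ n ∈ S := fun n => by
    have hr : γ ^ (n % ρ) ∈ S := Submodule.subset_span ⟨⟨n % ρ, Nat.mod_lt _ hρ⟩, rfl⟩
    rw [← Nat.div_add_mod n ρ, pow_add, pow_mul, hγ]
    rcases neg_one_pow_eq_or L (n / ρ) with h | h <;> rw [h]
    · simpa using hr
    · simpa using hr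
  have halg : Algebra.adjoin K {γ} = ⊤ := by
    rw [← IntermediateField.adjoin_simple_toSubalgebra_of_isAlgebraic
      (Algebra.IsAlgebraic.isAlgebraic γ), htop, IntermediateField.top_toSubalgebra]
  rw [← top_le_iff, ← Algebra.top_toSubmodule, ← halg, Algebra.adjoin_eq_span,
    Submodule.span_le]
  intro x hx
  obtain ⟨n, rfl⟩ := Submonoid.mem_closure_singleton.1 hx
  exact hmem n

theorem eq_zero_of_trace_mul_pow [FiniteDimensional K L] [Algebra.IsSeparable K L] {γ : L}
    (hspan : Submodule.span K (Set.range fun i : Fin ρ => γ ^ i.val) = ⊤) {a : L}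
    (ha : ∀ i : Fin ρ, Algebra.trace K L (a * γ ^ i.val) = 0) : a = 0 := by
  refine (traceForm_nondegenerate K L).1 a fun y => ?_
  have hle : Submodule.span K (Set.range fun i : Fin ρ => γ ^ i.val)
      ≤ LinearMap.ker (Algebra.traceForm K L a) := by
    rw [Submodule.span_le]
    rintro _ ⟨i, rfl⟩
    exact ha i
  exact hle (hspan ▸ Submodule.mem_top)

theorem finrank_barCode [FiniteDimensional K L] [Algebra.IsSeparable K L]
    (hspan : Submodule.span K (Set.range fun i : Fin ρ => (β⁻¹ ^ 2) ^ i.val) = ⊤) :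
    Module.finrank K (barCode K ρ β) = Module.finrank K L := by
  refine LinearMap.finrank_range_of_inj ((injective_iff_map_eq_zero _).2 fun a ha => ?_)
  refine eq_zero_of_trace_mul_pow hspan fun i => ?_
  rw [← pow_mul]
  exact congr_fun ha i

/-- Nondegeneracy of the trace form turns orthogonality to all trace words into one parity check: as
a polynomial, c vanishes at θ². -/
theorem mem_dualCode_barCode [FiniteDimensional K L] [Algebra.IsSeparable K L] (c : Fin ρ → K) :
    c ∈ dualCode (barCode K ρ β) ↔ ∑ i : Fin ρ, c i • (β⁻¹ ^ 2) ^ i.val = 0 := by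
  have key : ∀ a : L, ∑ i, c i * Algebra.trace K L (a * β⁻¹ ^ (2 * i.val))
      = Algebra.trace K L ((∑ i : Fin ρ, c i • (β⁻¹ ^ 2) ^ i.val) * a) := fun a => by
    rw [Finset.sum_mul, map_sum]
    refine Finset.sum_congr rfl fun i _ => ?_
    rw [smul_mul_assoc, map_smul, smul_eq_mul, pow_mul, mul_comm a]
  constructor
  · intro hc
    refine (traceForm_nondegenerate K L).1 _ fun a => ?_
    rw [Algebra.traceForm_apply, ← key]
    exact hc _ ((mem_barCode ρ β _).2 ⟨a, rfl⟩)
  · intro hc b hb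
    obtain ⟨a, rfl⟩ := (mem_barCode ρ β b).1 hb
    rw [key, hc, zero_mul, map_zero]

theorem finrank_dualCode_barCode [FiniteDimensional K L] [Algebra.IsSeparable K L]
    (hspan : Submodule.span K (Set.range fun i : Fin ρ => (β⁻¹ ^ 2) ^ i.val) = ⊤) :
    Module.finrank K (dualCode (barCode K ρ β)) + Module.finrank K L = ρ := by
  set T : (Fin ρ → K) →ₗ[K] L := Fintype.linearCombination K fun i : Fin ρ => (β⁻¹ ^ 2) ^ i.val
    with hT
  have hker : dualCode (barCode K ρ β) = LinearMap.ker T := by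
    ext c
    rw [mem_dualCode_barCode, LinearMap.mem_ker, hT, Fintype.linearCombination_apply]
  have hrange : LinearMap.range T = ⊤ := by
    rw [hT, Fintype.range_linearCombination, hspan]
  have := T.finrank_range_add_finrank_ker
  rw [hrange, finrank_top, Module.finrank_fin_fun] at this
  rw [hker, add_comm, this]

end TraceCode

/-! ### From negacyclic to cyclic words. -/

section Twist

variable {K L : Type*} [Field K] [Field L] [Algebra K L] {ρ : ℕ} [NeZero ρ]

/-- The function on `ZMod ρ` obtained from the word `c` by alternating signs. -/
def twist (L : Type*) [Field L] [Algebra K L] (c : Fin ρ → K) (x : ZMod ρ) : L :=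
  (-1) ^ x.val * algebraMap K L (c ⟨x.val, x.val_lt⟩)

theorem support_twist_ncard (c : Fin ρ → K) :
    (Function.support (twist L c)).ncard = (Function.support c).ncard := by
  refine Set.ncard_congr (fun x _ => ⟨x.val, x.val_lt⟩) (fun x hx => ?_) (fun x y _ _ h => ?_)
    fun i hi => ?_
  · intro h
    exact hx (by simp [twist, h])
  · exact ZMod.val_injective ρ (congr_arg Fin.val h)
  · have hval : ((i.val : ℕ) : ZMod ρ).val = i.val := ZMod.val_natCast_of_lt i.isLt
    refine ⟨(i.val : ZMod ρ), ?_, Fin.ext hval⟩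
    simpa [twist, hval] using hi

theorem twist_ne_zero {c : Fin ρ → K} (hc : c ≠ 0) : twist L c ≠ 0 := by
  rw [← Function.support_nonempty_iff, ← Set.ncard_pos (Set.toFinite _), support_twist_ncard,
    Set.ncard_pos (Set.toFinite _), Function.support_nonempty_iff]
  exact hc

theorem fourier_twist_one {γ : L} (h : (-γ) ^ ρ = 1) [Fact ρ.Prime] (c : Fin ρ → K) :
    fourier (AddChar.zmodChar ρ h) (twist L c) 1 = ∑ i : Fin ρ, c i • γ ^ i.val := by
  let e : ZMod ρ ≃ Fin ρ :=
    { toFun := fun x => ⟨x.val, x.val_lt⟩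
      invFun := fun i => (i.val : ZMod ρ)
      left_inv := fun x => ZMod.natCast_zmod_val x
      right_inv := fun i => Fin.ext (ZMod.val_natCast_of_lt i.isLt) }
  rw [fourier, ← Equiv.sum_comp e]
  refine Finset.sum_congr rfl fun x _ => ?_
  have he : e x = ⟨x.val, x.val_lt⟩ := rfl
  rw [mul_one, AddChar.zmodChar_apply, twist, he, Algebra.smul_def, neg_pow γ, mul_right_comm,
    ← mul_assoc, ← mul_pow]
  simp [mul_comm]

end Twist

/-! ### Identification with quadratic residue codes over GF(9). -/

section Nonary

/-- The map x ↦ x⁹ is a ring endomorphism in characteristic 3 and fixes the values of f; hence zero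
sets are stable under multiplication by 9. -/
theorem fourier_nine_mul {F L : Type*} [Field F] [Fintype F] [Field L] [CharP L 3]
    (ψ : AddChar F L) {f : F → L} (hf : ∀ x, f x ^ 9 = f x) (r : F) :
    fourier ψ f (9 * r) = fourier ψ f r ^ 9 := by
  have : Fact (Nat.Prime 3) := ⟨Nat.prime_three⟩
  rw [fourier, fourier, show (9 : ℕ) = 3 ^ 2 by norm_num, sum_pow_char_pow]
  refine Finset.sum_congr rfl fun x _ => ?_
  rw [mul_pow, show (3 : ℕ) ^ 2 = 9 by norm_num, hf, ← AddChar.map_nsmul_eq_pow]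
  congr 2
  rw [nsmul_eq_mul]
  push_cast
  ring

theorem exists_eq_nine_pow {ρ : ℕ} [Fact ρ.Prime] (hord : orderOf (3 : ZMod ρ) = ρ - 1)
    {r : ZMod ρ} (hr : r ≠ 0) (hsq : IsSquare r) : ∃ j : ℕ, r = 9 ^ j := by
  obtain ⟨s, rfl⟩ := hsq
  have hs : s ≠ 0 := left_ne_zero_of_mul hr
  have hp : 0 < ρ - 1 := Nat.sub_pos_of_lt (Fact.out : ρ.Prime).one_lt
  have : NeZero (ρ - 1) := ⟨hp.ne'⟩
  obtain ⟨j, -, rfl⟩ := (hord ▸ IsPrimitiveRoot.orderOf (3 : ZMod ρ)).eq_pow_of_pow_eq_one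
    (ZMod.pow_card_sub_one_eq_one hs)
  exact ⟨j, by rw [← mul_pow]; norm_num⟩

variable {K L : Type*} [Field K] [Field L] [Algebra K L] {ρ : ℕ}

/-- If γ generates a degree k extension, then ρ ∣ 9^k - 1, so ρ - 1 ∣ 2k, which forces full degree.
-/
theorem adjoin_eq_top_of_orderOf_three [Finite L] (hK : Nat.card K = 9) {γ : L}
    (hprime : ρ.Prime) (hη : IsPrimitiveRoot (-γ) ρ) (hord : orderOf (3 : ZMod ρ) = ρ - 1)
    (hdim : 2 * Module.finrank K L = ρ - 1) : IntermediateField.adjoin K {γ} = ⊤ := by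
  set E := IntermediateField.adjoin K {γ} with hE
  have hk : 0 < Module.finrank K E := Module.finrank_pos
  refine IntermediateField.eq_of_le_of_finrank_le le_top ?_
  have hcard : Nat.card E = 9 ^ Module.finrank K E := by
    rw [Module.natCard_eq_pow_finrank (K := K), hK]
  have hmem : -γ ∈ E := E.neg_mem (IntermediateField.mem_adjoin_simple_self K γ)
  have : Fintype E := Fintype.ofFinite E
  have hpow : (-γ) ^ (9 ^ Module.finrank K E) = -γ := by
    have := FiniteField.pow_card (⟨-γ, hmem⟩ : E)
    rw [← Nat.card_eq_fintype_card, hcard] at this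
    exact congr_arg Subtype.val this
  have h0 : -γ ≠ 0 := hη.ne_zero hprime.ne_zero
  have hpos : 0 < 9 ^ Module.finrank K E := by positivity
  have hdvd : ρ ∣ 9 ^ Module.finrank K E - 1 := by
    refine hη.dvd_of_pow_eq_one _ (mul_right_cancel₀ h0 ?_)
    rw [← pow_succ, Nat.sub_add_cancel hpos, hpow, one_mul]
  have h3 : (3 : ZMod ρ) ^ (2 * Module.finrank K E) = 1 := by
    rw [← CharP.cast_eq_zero_iff (ZMod ρ) ρ, Nat.cast_sub hpos] at hdvd
    push_cast at hdvd
    rw [pow_mul, ← sub_eq_zero, ← hdvd]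
    norm_num
  have := Nat.le_of_dvd (by omega) (hord ▸ orderOf_dvd_of_pow_eq_one h3)
  rw [IntermediateField.finrank_top']
  omega

/-- The quadratic character with values in `L`. -/
def quadChar (ρ : ℕ) [Fact ρ.Prime] (L : Type*) [Field L] : MulChar (ZMod ρ) L :=
  (quadraticChar (ZMod ρ)).ringHomComp (Int.castRingHom L)

variable [Fact ρ.Prime]

theorem quadChar_isQuadratic : MulChar.IsQuadratic (quadChar ρ L) :=
  (quadraticChar_isQuadratic (ZMod ρ)).comp _

theorem neg_one_ne_one_of_two_ne_zero (h2 : (2 : L) ≠ 0) : (-1 : L) ≠ 1 := fun h =>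
  h2 (by linear_combination -h)

theorem quadChar_ne_one (h2 : (2 : L) ≠ 0) (hρ : ρ ≠ 2) : quadChar ρ L ≠ 1 := by
  obtain ⟨a, ha⟩ := quadraticChar_exists_neg_one (F := ZMod ρ) (by rwa [ZMod.ringChar_zmod_n])
  have ha0 : a ≠ 0 := by
    rintro rfl
    simp at ha
  refine MulChar.ne_one_iff.2 ⟨Units.mk0 a ha0, ?_⟩
  simpa [quadChar, ha] using neg_one_ne_one_of_two_ne_zero h2

theorem isSquare_of_quadChar_eq_one (h2 : (2 : L) ≠ 0) {r : ZMod ρ} (hr : quadChar ρ L r = 1) :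
    r ≠ 0 ∧ IsSquare r := by
  have hr0 : r ≠ 0 := by
    rintro rfl
    simp [MulChar.map_zero] at hr
  refine ⟨hr0, (quadraticChar_one_iff_isSquare hr0).1 ?_⟩
  rcases quadraticChar_isQuadratic (ZMod ρ) r with h | h | h
  · simp [quadChar, h] at hr
  · exact h
  · simp only [quadChar, MulChar.ringHomComp_apply, h] at hr
    exact absurd (by simpa using hr) (neg_one_ne_one_of_two_ne_zero h2)

theorem fourier_twist_dual [CharP L 3] (hK : Nat.card K = 9) {γ : L} (h : (-γ) ^ ρ = 1)
    (h2 : (2 : L) ≠ 0) (hord : orderOf (3 : ZMod ρ) = ρ - 1) {c : Fin ρ → K}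
    (hc : ∑ i : Fin ρ, c i • γ ^ i.val = 0) (r : ZMod ρ) (hr : quadChar ρ L r = 1) :
    fourier (AddChar.zmodChar ρ h) (twist L c) r = 0 := by
  obtain ⟨hr0, hsq⟩ := isSquare_of_quadChar_eq_one h2 hr
  obtain ⟨j, rfl⟩ := exists_eq_nine_pow hord hr0 hsq
  have : Finite K := Nat.finite_of_card_ne_zero (by rw [hK]; norm_num)
  have : Fintype K := Fintype.ofFinite K
  have hf : ∀ x, twist L c x ^ 9 = twist L c x := fun x => by
    have h9 : ∀ a : K, a ^ 9 = a := fun a => by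
      have := FiniteField.pow_card a
      rwa [← Nat.card_eq_fintype_card, hK] at this
    rw [twist, mul_pow, ← map_pow, h9, ← pow_mul, mul_comm, pow_mul']
    norm_num [mul_comm]
  clear hr hr0 hsq
  induction j with
  | zero => rw [pow_zero, fourier_twist_one, hc]
  | succ j ih => rw [pow_succ', fourier_nine_mul _ hf, ih, zero_pow (by norm_num)]

/-- The trace is the sum of the conjugates under x ↦ x⁹, so the twisted word is a combination of the
characters x ↦ ψ(9^j x), and orthogonality leaves only the frequencies -9^j. -/
theorem fourier_twist_trace [Finite L] (hK : Nat.card K = 9) {γ : L} (hη : IsPrimitiveRoot (-γ) ρ)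
    (a : L) (r : ZMod ρ) (hr : ∀ j : ℕ, r ≠ -9 ^ j) :
    fourier (AddChar.zmodChar ρ hη.pow_eq_one)
      (twist L fun i : Fin ρ => Algebra.trace K L (a * γ ^ i.val)) r = 0 := by
  set ψ := AddChar.zmodChar ρ hη.pow_eq_one with hψ
  have hprim : ψ.IsPrimitive := AddChar.zmodChar_primitive_of_primitive_root ρ hη
  have htw : ∀ x, twist L (fun i : Fin ρ => Algebra.trace K L (a * γ ^ i.val)) x
      = ∑ j ∈ Finset.range (Module.finrank K L), a ^ 9 ^ j * ψ (x * 9 ^ j) := fun x => by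
    rw [twist, FiniteField.algebraMap_trace_eq_sum_pow, Finset.mul_sum, hK]
    refine Finset.sum_congr rfl fun j _ => ?_
    -- Oddness lets the sign (-1)^x pass through the power 9^j, turning γ into -γ.
    have hodd : Odd (9 ^ j) := Odd.pow (by decide)
    have h1 : ψ (x * 9 ^ j) = ((-γ) ^ x.val) ^ 9 ^ j := by
      rw [← AddChar.zmodChar_apply hη.pow_eq_one, ← hψ, ← AddChar.map_nsmul_eq_pow, nsmul_eq_mul,
        mul_comm]
      push_cast
      rfl
    rw [h1, neg_pow γ, mul_pow, mul_pow, ← pow_mul (-1 : L), mul_comm x.val, pow_mul,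
      hodd.neg_one_pow]
    ring
  simp only [fourier, htw, Finset.sum_mul]
  rw [Finset.sum_comm]
  refine Finset.sum_eq_zero fun j _ => ?_
  have hsum := AddChar.sum_mulShift (9 ^ j + r) hprim
  rw [if_neg fun h => hr j (by linear_combination h), Nat.cast_zero] at hsum
  rw [← mul_zero (a ^ 9 ^ j), ← hsum, Finset.mul_sum]
  refine Finset.sum_congr rfl fun x _ => ?_
  rw [mul_add, AddChar.map_add_eq_mul, mul_assoc]

theorem quadChar_neg_nine_pow (h3 : (3 : ZMod ρ) ≠ 0) (j : ℕ) :
    quadChar ρ L (-9 ^ j) = quadChar ρ L (-1) := by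
  have h := (quadChar_isQuadratic (ρ := ρ) (L := L)).mul_self h3
  rw [← neg_one_mul, map_mul, map_pow, show (9 : ZMod ρ) = 3 * 3 by norm_num, map_mul, h, one_pow,
    mul_one]

theorem sqrt_le_support_dual [CharP L 3] (hK : Nat.card K = 9) {γ : L}
    (hη : IsPrimitiveRoot (-γ) ρ) (hρ2 : ρ ≠ 2) (h2 : (2 : L) ≠ 0) (hρ : (ρ : L) ≠ 0)
    (hord : orderOf (3 : ZMod ρ) = ρ - 1) {c : Fin ρ → K} (hc0 : c ≠ 0)
    (hc : ∑ i : Fin ρ, c i • γ ^ i.val = 0) :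
    ρ ≤ (Function.support c).ncard ^ 2 := by
  have := card_le_support_sq_of_ne_zero (ε := 1) (quadChar_isQuadratic (ρ := ρ) (L := L))
    (quadChar_ne_one h2 hρ2) (AddChar.zmodChar_primitive_of_primitive_root ρ hη) h2
    (by rwa [ZMod.card]) (Or.inl rfl) (fourier_twist_dual hK hη.pow_eq_one h2 hord hc)
    (twist_ne_zero hc0)
  rwa [ZMod.card, support_twist_ncard] at this

theorem sqrt_le_support_barCode [Finite L] (hK : Nat.card K = 9) {β : L}
    (hη : IsPrimitiveRoot (-(β⁻¹ ^ 2)) ρ) (hρ2 : ρ ≠ 2) (h2 : (2 : L) ≠ 0) (hρ : (ρ : L) ≠ 0)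
    (h3 : (3 : ZMod ρ) ≠ 0) {c : Fin ρ → K} (hc0 : c ≠ 0) (hc : c ∈ barCode K ρ β) :
    ρ ≤ ((Function.support c).ncard - 1) ^ 2 := by
  obtain ⟨a, ha⟩ := (mem_barCode ρ β c).1 hc
  simp only [pow_mul] at ha
  have hq := quadChar_isQuadratic (ρ := ρ) (L := L)
  have hm1 := hq.eq_one_or_neg_one (x := -1) (by simp)
  have h9 : (9 : ZMod ρ) ≠ 0 := by
    rw [show (9 : ZMod ρ) = 3 * 3 by norm_num]
    exact mul_ne_zero h3 h3
  -- All frequencies -9^j have character χ(-1), so the transform vanishes on the opposite class.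
  have := card_le_support_sub_one_sq (ε := -quadChar ρ L (-1)) (f := twist L c) hq
    (quadChar_ne_one h2 hρ2) (AddChar.zmodChar_primitive_of_primitive_root ρ hη) h2
    (by rwa [ZMod.card]) (by rcases hm1 with h | h <;> simp [h])
    (fun r hr => by
      rw [ha]
      refine fourier_twist_trace hK hη a r fun j hj => ?_
      rw [hj, quadChar_neg_nine_pow h3] at hr
      have h0 : quadChar ρ L (-1) ≠ 0 := by rcases hm1 with h | h <;> simp [h]
      exact mul_ne_zero h2 h0 (by linear_combination hr))
    (by
      rw [ha]
      exact fourier_twist_trace hK hη a 0 fun j hj => pow_ne_zero j h9 (by simpa using hj))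
    (twist_ne_zero hc0)
  rwa [ZMod.card, support_twist_ncard] at this

end Nonary

end Negacyclic

/-! ### Roots of unity and the main theorem. -/

namespace Negacyclic

theorem four_mul_dvd_three_pow_sub_one {ρ : ℕ} (hprime : ρ.Prime) (h2 : ρ ≠ 2) (h3 : ρ ≠ 3) :
    4 * ρ ∣ 3 ^ (ρ - 1) - 1 := by
  have : Fact ρ.Prime := ⟨hprime⟩
  have hodd : Odd ρ := hprime.odd_of_ne_two h2
  have hcop : Nat.Coprime 4 ρ := (Nat.coprime_pow_left_iff (n := 2) (by norm_num) 2 ρ).2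
    hodd.coprime_two_left
  refine hcop.mul_dvd_of_dvd_of_dvd ?_ ?_
  · obtain ⟨k, hk⟩ := hodd
    rw [hk, Nat.add_sub_cancel, pow_mul]
    have h := Nat.sub_dvd_pow_sub_pow (3 ^ 2) 1 k
    rw [one_pow] at h
    exact (show 4 ∣ 3 ^ 2 - 1 by norm_num).trans h
  · have h0 : ((3 : ℕ) : ZMod ρ) ≠ 0 := fun h =>
      h3 ((Nat.prime_dvd_prime_iff_eq hprime Nat.prime_three).1
        ((CharP.cast_eq_zero_iff (ZMod ρ) ρ 3).1 h))
    rw [← CharP.cast_eq_zero_iff (ZMod ρ) ρ, Nat.cast_sub (Nat.one_le_pow _ _ (by norm_num)),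
      Nat.cast_pow, ZMod.pow_card_sub_one_eq_one h0, Nat.cast_one, sub_self]

theorem isPrimitiveRoot_neg_of_two_mul {L : Type*} [Field L] {ρ : ℕ} (hprime : ρ.Prime)
    (h2 : ρ ≠ 2) {γ : L} (hγ : IsPrimitiveRoot γ (2 * ρ)) :
    γ ^ ρ = -1 ∧ IsPrimitiveRoot (-γ) ρ := by
  have : Fact ρ.Prime := ⟨hprime⟩
  have h1 : γ ^ ρ = -1 := by
    refine (sq_eq_one_iff.1 ?_).resolve_left
      (hγ.pow_ne_one_of_pos_of_lt hprime.ne_zero (by have := hprime.pos; omega))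
    rw [← pow_mul, mul_comm, hγ.pow_eq_one]
  refine ⟨h1, ?_⟩
  have hne : -γ ≠ 1 := fun h => by
    have := hγ.pow_ne_one_of_pos_of_lt (l := 2) (by norm_num)
      (by have := hprime.two_le; omega)
    exact this (by linear_combination (1 - γ) * h)
  rw [← orderOf_eq_prime (p := ρ) _ hne]
  · exact IsPrimitiveRoot.orderOf _
  · rw [(hprime.odd_of_ne_two h2).neg_pow, h1, neg_neg]

end Negacyclic

theorem mainTheorem10 (ρ : ℕ) (hprime : ρ.Prime)
    (hmod : ρ ≡ 5 [MOD 12] ∨ ρ ≡ 7 [MOD 12])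
    (hord : orderOf (3 : ZMod ρ) = ρ - 1)
    {K L : Type*} [Field K] [Field L] [Algebra K L]
    (hK : Nat.card K = 3 ^ 2) (hL : Nat.card L = 3 ^ (ρ - 1))
    (α : L) (hα : IsPrimitiveRoot α (3 ^ (ρ - 1) - 1))
    (β : L) (hβ : β = α ^ ((3 ^ (ρ - 1) - 1) / (4 * ρ))) :
    Negacyclic.IsNegacyclic (Negacyclic.barCode K ρ β) ∧
    (∃ d : ℕ, Negacyclic.HasParameters (Negacyclic.barCode K ρ β) ((ρ - 1) / 2) d ∧
      Real.sqrt (ρ : ℝ) + 1 ≤ (d : ℝ)) ∧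
    (∃ d : ℕ, Negacyclic.HasParameters (Negacyclic.dualCode (Negacyclic.barCode K ρ β))
        ((ρ + 1) / 2) d ∧
      Real.sqrt (ρ : ℝ) ≤ (d : ℝ)) := by
  have hρ5 : 5 ≤ ρ := by
    have hp := hprime.two_le
    simp only [Nat.ModEq] at hmod
    omega
  have hρ2 : ρ ≠ 2 := by omega
  have hρ3 : ρ ≠ 3 := by omega
  have : Fact ρ.Prime := ⟨hprime⟩
  have : Fact (Nat.Prime 3) := ⟨Nat.prime_three⟩
  have hK9 : Nat.card K = 9 := by rw [hK]; norm_num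
  have : Finite L := Nat.finite_of_card_ne_zero (by rw [hL]; positivity)
  have : Finite K := Nat.finite_of_card_ne_zero (by rw [hK]; positivity)
  have : Fintype L := Fintype.ofFinite L
  have : CharP L 3 := charP_of_card_eq_prime_pow (f := ρ - 1) (by
    rw [← Nat.card_eq_fintype_card, hL])
  have hcast : ∀ p : ℕ, p.Prime → p ≠ 3 → (p : L) ≠ 0 := fun p hp hp3 h =>
    hp3 ((Nat.prime_dvd_prime_iff_eq Nat.prime_three hp).1
      ((CharP.cast_eq_zero_iff L 3 p).1 h)).symm
  have h2 : (2 : L) ≠ 0 := by exact_mod_cast hcast 2 Nat.prime_two (by norm_num)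
  have hρL : (ρ : L) ≠ 0 := hcast ρ hprime hρ3
  have h3 : (3 : ZMod ρ) ≠ 0 := fun h => hρ3 ((Nat.prime_dvd_prime_iff_eq hprime
    Nat.prime_three).1 ((CharP.cast_eq_zero_iff (ZMod ρ) ρ 3).1 (by exact_mod_cast h)))
  have hdim : 2 * Module.finrank K L = ρ - 1 := by
    have h := Module.natCard_eq_pow_finrank (K := K) (V := L)
    rw [hL, hK, ← pow_mul] at h
    exact (Nat.pow_right_injective (by norm_num) h).symm
  have hβp : IsPrimitiveRoot β (4 * ρ) := by
    rw [hβ]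
    exact hα.pow (Nat.sub_pos_of_lt (Nat.one_lt_pow (by omega) (by norm_num)))
      (Nat.div_mul_cancel (Negacyclic.four_mul_dvd_three_pow_sub_one hprime hρ2 hρ3)).symm
  have hγp : IsPrimitiveRoot (β⁻¹ ^ 2) (2 * ρ) := hβp.inv.pow (by omega) (by ring)
  obtain ⟨hγ, hη⟩ := Negacyclic.isPrimitiveRoot_neg_of_two_mul hprime hρ2 hγp
  have hspan := Negacyclic.span_pow_eq_top hprime.pos hγ
    (Negacyclic.adjoin_eq_top_of_orderOf_three hK9 hprime hη hord hdim)
  have hC := Negacyclic.finrank_barCode hspan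
  have hD := Negacyclic.finrank_dualCode_barCode hspan
  have hodd := (hprime.eq_two_or_odd).resolve_left hρ2
  have hne : ∀ C : Submodule K (Fin ρ → K), 0 < Module.finrank K C → C ≠ ⊥ := by
    rintro C hC rfl
    simp at hC
  refine ⟨Negacyclic.barCode_isNegacyclic (hβp.ne_zero (by omega)) (by rw [pow_mul, hγ]),
    ⟨_, ⟨by omega, rfl⟩, ?_⟩, ⟨_, ⟨by omega, rfl⟩, ?_⟩⟩
  · obtain ⟨c, hc, hc0, h⟩ := Negacyclic.exists_support_ncard_eq_minDist
      (hne (Negacyclic.barCode K ρ β) (by omega))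
    have hb := Negacyclic.sqrt_le_support_barCode hK9 hη hρ2 h2 hρL h3 hc0 hc
    rw [h] at hb
    -- Were the distance 0, truncated subtraction would turn the bound into ρ ≤ 0.
    have h1 : 1 ≤ Negacyclic.minDist (Negacyclic.barCode K ρ β) := by
      by_contra hlt
      rw [Nat.sub_eq_zero_of_le (by omega)] at hb
      omega
    rw [← le_sub_iff_add_le, ← Nat.cast_one, ← Nat.cast_sub h1]
    exact Real.sqrt_le_iff.2 ⟨Nat.cast_nonneg _, by exact_mod_cast hb⟩
  · obtain ⟨c, hc, hc0, h⟩ := Negacyclic.exists_support_ncard_eq_minDist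
      (hne (Negacyclic.dualCode (Negacyclic.barCode K ρ β)) (by omega))
    have hb := Negacyclic.sqrt_le_support_dual hK9 hη hρ2 h2 hρL hord hc0
      ((Negacyclic.mem_dualCode_barCode c).1 hc)
    rw [h] at hb
    exact Real.sqrt_le_iff.2 ⟨Nat.cast_nonneg _, by exact_mod_cast hb⟩
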